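/- Regard a permutation of $[n]=\{1,\dots,n\}$ as an $n$-tuple $\pi=(\pi(1),\dots,\pi(n))$ in which every integer of $[n]$ occurs exactly once. A \emph{run} of $\pi$ is a maximal decreasing sequence of consecutive entries, and $\mathrm{Pop}(\pi)$ denotes the permutation obtained from $\pi$ by reversing every run (one step of Pop-Stack Sorting). Let $\sigma_n$ be a uniformly random permutation of $[n]$. Then asymptotically almost surely, that is, with probability tending to $1$ as $n\to\infty$, Pop-Stack Sorting needs at least $0.503\,n$ steps to reach the identity permutation $\mathrm{Id}_n$ from $\sigma_n$: every integer $t\ge 0$ with $\mathrm{Pop}^t(\sigma_n)=\mathrm{Id}_n$ satisfies $t\ge 0.503\,n$. In particular, there is a constant $c>1/2$ such that asymptotically almost surely Pop-Stack Sorting needs at least $cn$ steps to reach $\mathrm{Id}_n$ from $\sigma_n$, which answers a question of Defant affirmatively. -/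

import Mathlib

open Filter Topology

namespace PopStack

/-! A permutation `σ : Equiv.Perm (Fin n)` is read as the word `σ 0, σ 1, …, σ (n - 1)`, so
`σ i` is the entry in position `i` and `σ⁻¹ k` is the position of the entry `k`. Positions and
entries are numbered from `0` instead of from `1`. -/

/-- The entries of `σ` in the positions `a, a + 1, …, b` are decreasing. -/
abbrev DecreasingOn {n : ℕ} (σ : Equiv.Perm (Fin n)) (a b : Fin n) : Prop :=
  ∀ k l : Fin n, a ≤ k → k < l → l ≤ b → σ l < σ k

theorem decreasingOn_self {n : ℕ} (σ : Equiv.Perm (Fin n)) (i : Fin n) : DecreasingOn σ i i :=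
  fun _ _ h1 h2 h3 => absurd (h1.trans_lt (h2.trans_le h3)) (lt_irrefl i)

/-- The first position of the maximal decreasing run of `σ` that contains position `i`. -/
def runStart {n : ℕ} (σ : Equiv.Perm (Fin n)) (i : Fin n) : Fin n :=
  (Finset.univ.filter fun j : Fin n => j ≤ i ∧ DecreasingOn σ j i).min'
    ⟨i, by simpa using decreasingOn_self σ i⟩

/-- The last position of the maximal decreasing run of `σ` that contains position `i`. -/
def runEnd {n : ℕ} (σ : Equiv.Perm (Fin n)) (i : Fin n) : Fin n :=
  (Finset.univ.filter fun j : Fin n => i ≤ j ∧ DecreasingOn σ i j).max'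
    ⟨i, by simpa using decreasingOn_self σ i⟩

theorem runStart_spec {n : ℕ} (σ : Equiv.Perm (Fin n)) (i : Fin n) :
    runStart σ i ≤ i ∧ DecreasingOn σ (runStart σ i) i := by
  have h := Finset.min'_mem (Finset.univ.filter fun j : Fin n => j ≤ i ∧ DecreasingOn σ j i)
    ⟨i, by simpa using decreasingOn_self σ i⟩
  exact (Finset.mem_filter.1 h).2

theorem runEnd_spec {n : ℕ} (σ : Equiv.Perm (Fin n)) (i : Fin n) :
    i ≤ runEnd σ i ∧ DecreasingOn σ i (runEnd σ i) := by
  have h := Finset.max'_mem (Finset.univ.filter fun j : Fin n => i ≤ j ∧ DecreasingOn σ i j)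
    ⟨i, by simpa using decreasingOn_self σ i⟩
  exact (Finset.mem_filter.1 h).2

theorem runStart_le {n : ℕ} {σ : Equiv.Perm (Fin n)} {i j : Fin n} (h : j ≤ i)
    (hd : DecreasingOn σ j i) : runStart σ i ≤ j :=
  Finset.min'_le _ _ (Finset.mem_filter.2 ⟨Finset.mem_univ _, h, hd⟩)

theorem le_runEnd {n : ℕ} {σ : Equiv.Perm (Fin n)} {i j : Fin n} (h : i ≤ j)
    (hd : DecreasingOn σ i j) : j ≤ runEnd σ i :=
  Finset.le_max' _ _ (Finset.mem_filter.2 ⟨Finset.mem_univ _, h, hd⟩)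

theorem DecreasingOn.glue {n : ℕ} {σ : Equiv.Perm (Fin n)} {a i b : Fin n}
    (h1 : DecreasingOn σ a i) (h2 : DecreasingOn σ i b) : DecreasingOn σ a b := by
  intro k l hk hkl hl
  rcases le_or_gt l i with hli | hli
  · exact h1 k l hk hkl hli
  · rcases lt_or_ge k i with hki | hki
    · exact (h2 i l le_rfl hli hl).trans (h1 k i hk hki le_rfl)
    · exact h2 k l hki hkl hl

theorem decreasingOn_run {n : ℕ} (σ : Equiv.Perm (Fin n)) (i : Fin n) :
    DecreasingOn σ (runStart σ i) (runEnd σ i) :=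
  DecreasingOn.glue (runStart_spec σ i).2 (runEnd_spec σ i).2

theorem run_eq {n : ℕ} (σ : Equiv.Perm (Fin n)) {i j : Fin n} (h1 : runStart σ i ≤ j)
    (h2 : j ≤ runEnd σ i) : runStart σ j = runStart σ i ∧ runEnd σ j = runEnd σ i := by
  have hr := decreasingOn_run σ i
  have a1 : runStart σ j ≤ runStart σ i :=
    runStart_le h1 fun k l hk hkl hl => hr k l hk hkl (hl.trans h2)
  have a2 : runEnd σ i ≤ runEnd σ j :=
    le_runEnd h2 fun k l hk hkl hl => hr k l (h1.trans hk) hkl hl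
  have hs := decreasingOn_run σ j
  have hi1 := (runStart_spec σ i).1
  have hi2 := (runEnd_spec σ i).1
  refine ⟨le_antisymm a1 ?_, le_antisymm ?_ a2⟩
  · exact runStart_le (a1.trans hi1) fun k l hk hkl hl => hs k l hk hkl (hl.trans (hi2.trans a2))
  · exact le_runEnd (hi2.trans a2) fun k l hk hkl hl => hs k l ((a1.trans hi1).trans hk) hkl hl

/-- The mirror image of position `i` inside the maximal decreasing run containing it. -/
def reflect {n : ℕ} (σ : Equiv.Perm (Fin n)) (i : Fin n) : Fin n :=
  ⟨(runStart σ i : ℕ) + (runEnd σ i : ℕ) - (i : ℕ), by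
    have h1 : (runStart σ i : ℕ) ≤ (i : ℕ) := (runStart_spec σ i).1
    have h2 := (runEnd σ i).isLt
    omega⟩

theorem reflect_involutive {n : ℕ} (σ : Equiv.Perm (Fin n)) :
    Function.Involutive (reflect σ) := by
  intro i
  have h1 : (runStart σ i : ℕ) ≤ (i : ℕ) := (runStart_spec σ i).1
  have h2 : (i : ℕ) ≤ (runEnd σ i : ℕ) := (runEnd_spec σ i).1
  have e : ((reflect σ i : Fin n) : ℕ) = (runStart σ i : ℕ) + (runEnd σ i : ℕ) - (i : ℕ) := rfl
  obtain ⟨r1, r2⟩ := run_eq σ (i := i) (j := reflect σ i)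
    (Fin.le_def.2 (by omega)) (Fin.le_def.2 (by omega))
  apply Fin.ext
  change (runStart σ (reflect σ i) : ℕ) + (runEnd σ (reflect σ i) : ℕ) - (reflect σ i : ℕ) = _
  rw [r1, r2, e]
  omega

/-- One step of Pop-Stack Sorting: every maximal run of consecutive decreasing entries is
reversed, that is, the new entry in position `i` is the old entry in the mirrored position. -/
def pop {n : ℕ} (σ : Equiv.Perm (Fin n)) : Equiv.Perm (Fin n) :=
  (reflect_involutive σ).toPerm.trans σ

/-- Pop-Stack Sorting needs at least `x` steps to reach the identity from `σ`: whenever the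
identity is reached after `t` steps, `t` is at least `x`. -/
def NeedsAtLeast {n : ℕ} (σ : Equiv.Perm (Fin n)) (x : ℝ) : Prop :=
  ∀ t : ℕ, pop^[t] σ = Equiv.refl (Fin n) → x ≤ (t : ℝ)

/-- For a uniformly random permutation of `n` elements, the event `E n` has probability tending
to `1` as `n` tends to infinity. -/
def HoldsAAS (E : ∀ n : ℕ, Set (Equiv.Perm (Fin n))) : Prop :=
  Tendsto (fun n : ℕ => (PMF.uniformOfFintype (Equiv.Perm (Fin n))).toOuterMeasure (E n))
    atTop (𝓝 1)

end PopStack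

/-!
From the second permutation on all runs have length at most three, so an entry moves by at most
two positions per step, and a random permutation has a very small entry very close to the right
end. This gives a lower bound of about `n / 2` steps. The improvement comes from showing that the
way to the left cannot consist of moves by two alone.

Consider the descents of the current permutation. A descent is never a descent in the next step
(`notMem_descents_pop`), and each descent of the next step is adjacent to a present one
(`exists_neighbour_mem_descents`). So if one takes an increasing sequence of descents whose
parities alternate and passes to neighbours one step earlier, one obtains such a sequence again
(`AltChain.transfer`): the greatest length of an alternating sequence of descents never grows.
Now let `r` be the rightmost position of an entry below `K`. If `r` moves left by two, then `r - 1`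
and `r - 2` are both descents, and one of them can be appended to a sequence to the left of the new
`r`. Hence each move by two uses up one unit of the length of an alternating sequence of
descents, and `r` moves by two at most as often as the length `m` of the longest such sequence in
the initial permutation allows. This is `rightmost_lt_add`; sorting takes about `n - m` steps.

It remains to see that `m` is well below `n / 2` for a random permutation. Cutting the positions
into blocks of three gives at most one member of the sequence per block, plus one for each
double descent inside the blocks (`AltChain.length_le`). A given triple is decreasing with
probability `1 / 6`, so `m` is at most about `n / 3 + 2 * n / 18 = 4 * n / 9`, and Chebyshev's
inequality for disjoint triples (`card_many_decreasing_mul_le`) makes this precise up to an error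
of `n / 30`. That small entries occur near the right end is a switching argument
(`card_avoid_mul_le`).
-/

namespace PopStack

/-! ### Descents under one step -/

section Descents

variable {n : ℕ} {σ : Equiv.Perm (Fin n)}

/-- The descents of `σ`: the positions `e` whose entry exceeds the entry in position `e + 1`.
Recorded as natural numbers so that parities and neighbours need no side conditions. -/
def descents (σ : Equiv.Perm (Fin n)) : Set ℕ :=
  {e | ∃ i j : Fin n, (i : ℕ) = e ∧ (j : ℕ) = e + 1 ∧ σ j < σ i}

theorem pop_apply (σ : Equiv.Perm (Fin n)) (i : Fin n) : pop σ i = σ (reflect σ i) := rfl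

theorem pop_reflect (σ : Equiv.Perm (Fin n)) (i : Fin n) : pop σ (reflect σ i) = σ i := by
  rw [pop_apply, reflect_involutive σ i]

theorem reflect_val (σ : Equiv.Perm (Fin n)) (i : Fin n) :
    (reflect σ i : ℕ) = (runStart σ i : ℕ) + (runEnd σ i : ℕ) - (i : ℕ) := rfl

theorem runStart_le_reflect (σ : Equiv.Perm (Fin n)) (i : Fin n) :
    runStart σ i ≤ reflect σ i := by
  have h2 : (i : ℕ) ≤ (runEnd σ i : ℕ) := (runEnd_spec σ i).1
  rw [Fin.le_def, reflect_val]
  omega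

theorem reflect_le_runEnd (σ : Equiv.Perm (Fin n)) (i : Fin n) :
    reflect σ i ≤ runEnd σ i := by
  have h1 : (runStart σ i : ℕ) ≤ (i : ℕ) := (runStart_spec σ i).1
  rw [Fin.le_def, reflect_val]
  omega

theorem DecreasingOn.mem_descents {a b : Fin n} (h : DecreasingOn σ a b) {e : ℕ}
    (ha : (a : ℕ) ≤ e) (hb : e + 1 ≤ (b : ℕ)) : e ∈ descents σ :=
  ⟨⟨e, by omega⟩, ⟨e + 1, by omega⟩, rfl, rfl,
    h _ _ (Fin.le_def.2 ha) (Fin.lt_def.2 (Nat.lt_succ_self e)) (Fin.le_def.2 hb)⟩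

theorem decreasingOn_of_lt {i j : Fin n} (hij : (i : ℕ) + 1 = j) (h : σ j < σ i) :
    DecreasingOn σ i j := by
  intro k l hk hkl hl
  rw [Fin.le_def] at hk hl
  rw [Fin.lt_def] at hkl
  have e1 : k = i := Fin.ext (by omega)
  have e2 : l = j := Fin.ext (by omega)
  rwa [e1, e2]

theorem lt_runStart_of_lt {i j : Fin n} (hij : i < j) (h : σ i < σ j) : i < runStart σ j := by
  by_contra hc
  exact lt_asymm h ((runStart_spec σ j).2 i j (not_lt.1 hc) hij le_rfl)

/-- A reversed run is increasing, so a descent is never a descent one step later. -/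
theorem notMem_descents_pop {e : ℕ} (he : e ∈ descents σ) : e ∉ descents (pop σ) := by
  obtain ⟨i, j, hi, hj, hlt⟩ := he
  rintro ⟨i', j', hi', hj', hlt'⟩
  obtain rfl : i' = i := Fin.ext (by omega)
  obtain rfl : j' = j := Fin.ext (by omega)
  have hle : j' ≤ runEnd σ i' :=
    le_runEnd (Fin.le_def.2 (by omega)) (decreasingOn_of_lt (by omega) hlt)
  obtain ⟨r1, r2⟩ := run_eq σ (i := i') (j := j')
    ((runStart_spec σ i').1.trans (Fin.le_def.2 (by omega))) hle
  have hlt2 : reflect σ j' < reflect σ i' := by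
    have h1 : (j' : ℕ) ≤ (runEnd σ i' : ℕ) := hle
    rw [Fin.lt_def, reflect_val, reflect_val, r1, r2]
    omega
  have hs : runStart σ i' ≤ reflect σ j' := r1 ▸ runStart_le_reflect σ j'
  exact lt_asymm hlt' (decreasingOn_run σ i' _ _ hs hlt2 (reflect_le_runEnd σ i'))

/-- Two neighbouring entries that both form runs of length one stay where they are. Hence a new
descent appears only next to an old one. -/
theorem exists_neighbour_mem_descents {f : ℕ} (hf : f ∈ descents (pop σ)) :
    ∃ e ∈ descents σ, e + 1 = f ∨ e = f + 1 := by
  have hnot : f ∉ descents σ := fun h => notMem_descents_pop h hf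
  obtain ⟨i, j, hi, hj, hlt⟩ := hf
  by_contra! hc
  have hi1 : (runStart σ i : ℕ) ≤ (i : ℕ) := (runStart_spec σ i).1
  have hi2 : (i : ℕ) ≤ (runEnd σ i : ℕ) := (runEnd_spec σ i).1
  have hj1 : (runStart σ j : ℕ) ≤ (j : ℕ) := (runStart_spec σ j).1
  have hj2 : (j : ℕ) ≤ (runEnd σ j : ℕ) := (runEnd_spec σ j).1
  have ei1 : (runStart σ i : ℕ) = i := by
    by_contra h
    exact (hc (f - 1) ((runStart_spec σ i).2.mem_descents (by omega) (by omega))).1 (by omega)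
  have ei2 : (runEnd σ i : ℕ) = i := by
    by_contra h
    exact hnot ((runEnd_spec σ i).2.mem_descents (by omega) (by omega))
  have ej1 : (runStart σ j : ℕ) = j := by
    by_contra h
    exact hnot ((runStart_spec σ j).2.mem_descents (by omega) (by omega))
  have ej2 : (runEnd σ j : ℕ) = j := by
    by_contra h
    exact (hc (f + 1) ((runEnd_spec σ j).2.mem_descents (by omega) (by omega))).2 rfl
  have ri : reflect σ i = i := Fin.ext (by rw [reflect_val]; omega)
  have rj : reflect σ j = j := Fin.ext (by rw [reflect_val]; omega)
  rw [pop_apply, pop_apply, ri, rj] at hlt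
  exact hnot ⟨i, j, hi, hj, hlt⟩

theorem not_three_descents_pop (σ : Equiv.Perm (Fin n)) (e : ℕ) :
    ¬(e ∈ descents (pop σ) ∧ e + 1 ∈ descents (pop σ) ∧ e + 2 ∈ descents (pop σ)) := by
  rintro ⟨h0, h1, h2⟩
  obtain ⟨d, hd, hd' | hd'⟩ := exists_neighbour_mem_descents h1
  · obtain rfl : d = e := by omega
    exact notMem_descents_pop hd h0
  · obtain rfl : d = e + 2 := by omega
    exact notMem_descents_pop hd h2

end Descents

/-! ### Chains of alternating parity -/

/-- `AltChain S m e` says that `S` contains `m ≥ 1` numbers `e₁ < e₂ < ⋯ < eₘ = e` of which any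
two consecutive ones have different parity. -/
inductive AltChain (S : Set ℕ) : ℕ → ℕ → Prop
  | single {e : ℕ} (he : e ∈ S) : AltChain S 1 e
  | snoc {m e f : ℕ} (h : AltChain S m e) (hlt : e < f) (hf : f ∈ S) (hodd : Odd (e + f)) :
      AltChain S (m + 1) f

theorem AltChain.mem {S : Set ℕ} {m e : ℕ} (h : AltChain S m e) : e ∈ S := by
  cases h <;> assumption

/-- Replacing each member of a chain by a neighbour flips all parities; the result is again
strictly increasing, because two members at distance `2` are never consecutive in the chain and
two members at distance `1` are not in `S`. -/
theorem AltChain.transfer {S S' : Set ℕ} (hdisj : ∀ e ∈ S, e ∉ S')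
    (hnear : ∀ f ∈ S', ∃ e ∈ S, e + 1 = f ∨ e = f + 1) {m f : ℕ} (h : AltChain S' m f) :
    ∃ e, AltChain S m e ∧ (e + 1 = f ∨ e = f + 1) := by
  induction h with
  | single hf =>
    obtain ⟨e, he, hef⟩ := hnear _ hf
    exact ⟨e, .single he, hef⟩
  | @snoc m f g _ hlt hg hodd ih =>
    obtain ⟨e, he, hef⟩ := ih
    obtain ⟨d, hd, hdg⟩ := hnear g hg
    have hne : e ≠ g := fun hh => hdisj e he.mem (hh ▸ hg)
    rw [Nat.odd_iff] at hodd
    exact ⟨d, he.snoc (by omega) hd (by rw [Nat.odd_iff]; omega), hdg⟩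

/-- If the numbers `0, 1, 2, …` are cut into blocks of three, then two consecutive members of a
chain lie in different blocks or are adjacent numbers in the same block. -/
theorem AltChain.length_le {S : Set ℕ} [DecidablePred (· ∈ S)] {m f : ℕ}
    (h : AltChain S m f) :
    m ≤ 1 + f / 3 +
      ((Finset.range f).filter fun e => e ∈ S ∧ e + 1 ∈ S ∧ e % 3 ≠ 2).card := by
  induction h with
  | single _ => omega
  | @snoc m e f he hlt hf hodd ih =>
    have hsub : (Finset.range e).filter (fun d => d ∈ S ∧ d + 1 ∈ S ∧ d % 3 ≠ 2) ⊆
        (Finset.range f).filter fun d => d ∈ S ∧ d + 1 ∈ S ∧ d % 3 ≠ 2 :=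
      Finset.filter_subset_filter _ (Finset.range_subset_range.2 hlt.le)
    by_cases hb : e / 3 < f / 3
    · have := Finset.card_le_card hsub
      omega
    · rw [Nat.odd_iff] at hodd
      obtain rfl : f = e + 1 := by omega
      have hss : (Finset.range e).filter (fun d => d ∈ S ∧ d + 1 ∈ S ∧ d % 3 ≠ 2) ⊂
          (Finset.range (e + 1)).filter fun d => d ∈ S ∧ d + 1 ∈ S ∧ d % 3 ≠ 2 := by
        refine (Finset.ssubset_iff_of_subset hsub).2 ⟨e, ?_, ?_⟩
        · simp only [Finset.mem_filter, Finset.mem_range]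
          exact ⟨Nat.lt_succ_self e, he.mem, hf, by omega⟩
        · simp
      have := Finset.card_lt_card hss
      omega

/-! ### The rightmost small entry -/

/-- If every run of `ρ` has length at most three, then the rightmost position `r` of an entry
below `K` moves left by at most two in each step, and a chain of descents to the left of it can be
lengthened by one whenever it does move by two. So it needs more than `r - K - m` steps to get
to its final position `K - 1`, where `m` is zero or the length of a chain of descents. -/
theorem rightmost_lt_add {n : ℕ} (K t : ℕ) : ∀ ρ : Equiv.Perm (Fin n),
    (∀ e, ¬(e ∈ descents ρ ∧ e + 1 ∈ descents ρ ∧ e + 2 ∈ descents ρ)) →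
    ∀ r : Fin n, (ρ r : ℕ) < K → (∀ i, r < i → K ≤ (ρ i : ℕ)) →
    pop^[t] ρ = Equiv.refl (Fin n) →
    (r : ℕ) < K + t ∨
      ∃ m e, AltChain (descents ρ) m e ∧ e < (r : ℕ) ∧ (r : ℕ) < K + t + m := by
  induction t with
  | zero =>
    intro ρ _ r hr _ hid
    left
    rw [Function.iterate_zero, id] at hid
    simpa [hid] using hr
  | succ t ih =>
    intro ρ hthree r hr hright hid
    rw [Function.iterate_succ_apply] at hid
    have hrs : (runStart ρ r : ℕ) ≤ r := (runStart_spec ρ r).1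
    have hrd := (runStart_spec ρ r).2
    have hne : (Finset.univ.filter fun i : Fin n => (pop ρ i : ℕ) < K).Nonempty :=
      ⟨reflect ρ r, by simpa [pop_reflect] using hr⟩
    obtain ⟨q, hq, hqmax⟩ := Finset.exists_max_image _ (fun i : Fin n => i) hne
    simp only [Finset.mem_filter, Finset.mem_univ, true_and] at hq hqmax
    have hq1 : (runStart ρ r : ℕ) ≤ q :=
      (runStart_le_reflect ρ r).trans (hqmax _ (by simpa [pop_reflect] using hr))
    have hq2 : (q : ℕ) ≤ r := by
      by_contra hlt
      have hlt : r < q := not_le.1 hlt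
      have h1 : r < runStart ρ q :=
        lt_runStart_of_lt hlt (Fin.lt_def.2 (hr.trans_le (hright q hlt)))
      exact absurd (hright _ (h1.trans_le (runStart_le_reflect ρ q))) (not_le.2 hq)
    have hq3 : (r : ℕ) ≤ (runStart ρ r : ℕ) + 2 := by
      by_contra hlt
      exact hthree (r - 3) ⟨hrd.mem_descents (by omega) (by omega),
        hrd.mem_descents (by omega) (by omega), hrd.mem_descents (by omega) (by omega)⟩
    have hrnot : (r : ℕ) ∉ descents ρ := by
      rintro ⟨i, j, hi, hj, hlt⟩
      obtain rfl : i = r := Fin.ext hi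
      have := hright j (Fin.lt_def.2 (by omega))
      rw [Fin.lt_def] at hlt
      omega
    have hrec := ih (pop ρ) (not_three_descents_pop ρ) q hq
      (fun i hi => not_lt.1 fun hlt => absurd (hqmax i hlt) (not_le.2 hi)) hid
    have htrans : ∀ {m f : ℕ}, AltChain (descents (pop ρ)) m f →
        ∃ e, AltChain (descents ρ) m e ∧ (e + 1 = f ∨ e = f + 1) := fun h =>
      h.transfer (fun _ he => notMem_descents_pop he) (fun _ hf => exists_neighbour_mem_descents hf)
    by_cases hstep : (r : ℕ) ≤ q + 1
    · rcases hrec with h | ⟨m, f, hch, hf, hm⟩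
      · left; omega
      · obtain ⟨e, he, hef⟩ := htrans hch
        have : e ≠ r := fun hh => hrnot (hh ▸ he.mem)
        exact Or.inr ⟨m, e, he, by omega, by omega⟩
    · have hd1 : (r : ℕ) - 1 ∈ descents ρ := hrd.mem_descents (by omega) (by omega)
      have hd2 : (r : ℕ) - 2 ∈ descents ρ := hrd.mem_descents (by omega) (by omega)
      rcases hrec with h | ⟨m, f, hch, hf, hm⟩
      · exact Or.inr ⟨1, _, .single hd1, by omega, by omega⟩
      · obtain ⟨e, he, hef⟩ := htrans hch
        -- One of `r - 1` and `r - 2` has the parity that extends the chain.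
        by_cases hpar : Odd (e + ((r : ℕ) - 1))
        · exact Or.inr ⟨m + 1, _, he.snoc (by omega) hd1 hpar, by omega, by omega⟩
        · rw [Nat.odd_iff] at hpar
          exact Or.inr ⟨m + 1, _, he.snoc (by omega) hd2 (by rw [Nat.odd_iff]; omega),
            by omega, by omega⟩

/-- A small entry far to the right after one step forces a long sorting time or a long chain of
descents in the original permutation. The first step is treated apart because the runs of `σ`
may be long. -/
theorem lt_add_of_iterate_pop {n : ℕ} {σ : Equiv.Perm (Fin n)} {K t : ℕ}
    (hid : pop^[t + 1] σ = Equiv.refl (Fin n)) {s : Fin n} (hs : (pop σ s : ℕ) < K) :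
    (s : ℕ) < K + t ∨ ∃ m e, AltChain (descents σ) m e ∧ (s : ℕ) < K + t + m := by
  have hne : (Finset.univ.filter fun i : Fin n => (pop σ i : ℕ) < K).Nonempty :=
    ⟨s, by simpa using hs⟩
  obtain ⟨r, hr, hmax⟩ := Finset.exists_max_image _ (fun i : Fin n => i) hne
  simp only [Finset.mem_filter, Finset.mem_univ, true_and] at hr hmax
  have hsr : (s : ℕ) ≤ r := hmax s hs
  rw [Function.iterate_succ_apply] at hid
  rcases rightmost_lt_add K t (pop σ) (not_three_descents_pop σ) r hr
    (fun i hi => not_lt.1 fun hlt => absurd (hmax i hlt) (not_le.2 hi)) hid with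
    h | ⟨m, f, hch, _, hm⟩
  · left; omega
  · obtain ⟨e, he, _⟩ := hch.transfer (fun _ he => notMem_descents_pop he)
      (fun _ hf => exists_neighbour_mem_descents hf)
    exact Or.inr ⟨m, e, he, by omega⟩

/-! ### Double descents of a random permutation -/

section DoubleDescents

variable {n : ℕ}

/-- The indicator that `σ` decreases along the three positions `p 0, p 1, p 2`, minus its mean. -/
noncomputable def centredTriple (p : Fin 3 ↪ Fin n) (σ : Equiv.Perm (Fin n)) : ℝ :=
  (if σ (p 2) < σ (p 1) ∧ σ (p 1) < σ (p 0) then 1 else 0) - 1 / 6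

theorem sum_perm_decreasing {α : Type*} [LinearOrder α] {h : Fin 3 → α}
    (hh : Function.Injective h) :
    ∑ τ : Equiv.Perm (Fin 3), (if h (τ 2) < h (τ 1) ∧ h (τ 1) < h (τ 0) then (1 : ℝ) else 0) =
      1 := by
  have huniv : (Finset.univ : Finset (Equiv.Perm (Fin 3))) =
      {1, Equiv.swap 0 1, Equiv.swap 0 2, Equiv.swap 1 2, Equiv.swap 0 1 * Equiv.swap 1 2,
        Equiv.swap 1 2 * Equiv.swap 0 1} := by decide
  have h01 : h 0 ≠ h 1 := fun e => by simpa using hh e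
  have h02 : h 0 ≠ h 2 := fun e => by simpa using hh e
  have h12 : h 1 ≠ h 2 := fun e => by simpa using hh e
  rw [huniv]
  repeat rw [Finset.sum_insert (by decide)]
  rw [Finset.sum_singleton]
  have s1 : ∀ a b c : Fin 3, a ≠ c → b ≠ c → Equiv.swap a b c = c :=
    fun a b c h1 h2 => Equiv.swap_apply_of_ne_of_ne h1.symm h2.symm
  simp only [Equiv.Perm.coe_one, id, Equiv.Perm.mul_apply, Equiv.swap_apply_left,
    Equiv.swap_apply_right, s1 0 1 2 (by decide) (by decide), s1 0 2 1 (by decide) (by decide),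
    s1 1 2 0 (by decide) (by decide)]
  rcases lt_or_gt_of_ne h01 with a | a <;> rcases lt_or_gt_of_ne h02 with b | b <;>
    rcases lt_or_gt_of_ne h12 with c | c <;>
    first
    | (simp [a, b, c, a.not_gt, b.not_gt, c.not_gt]; done)
    | exact absurd (a.trans c) b.not_gt
    | exact absurd (c.trans a) b.not_gt

/-- Rearranging the entries in the positions `p 0, p 1, p 2` in all six ways averages
`centredTriple p` to zero, so it is orthogonal to every function that does not notice this. -/
theorem sum_centredTriple_mul_eq_zero (p : Fin 3 ↪ Fin n) (g : Equiv.Perm (Fin n) → ℝ)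
    (hg : ∀ σ, ∀ τ : Equiv.Perm (Fin 3), g (σ * τ.viaEmbedding p) = g σ) :
    ∑ σ, centredTriple p σ * g σ = 0 := by
  have havg : ∀ σ : Equiv.Perm (Fin n),
      ∑ τ : Equiv.Perm (Fin 3), centredTriple p (σ * τ.viaEmbedding p) = 0 := by
    intro σ
    simp only [centredTriple, Equiv.Perm.mul_apply, Equiv.Perm.viaEmbedding_apply,
      Finset.sum_sub_distrib]
    rw [sum_perm_decreasing (h := fun i => σ (p i)) (σ.injective.comp p.injective)]
    simp [Fintype.card_perm, Nat.factorial]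
  have hshift : ∀ τ : Equiv.Perm (Fin 3),
      ∑ σ, centredTriple p (σ * τ.viaEmbedding p) * g σ = ∑ σ, centredTriple p σ * g σ := by
    intro τ
    rw [← Equiv.sum_comp (Equiv.mulRight (τ.viaEmbedding p))
      (fun σ => centredTriple p σ * g σ)]
    simp [hg]
  have hsix : ∑ τ : Equiv.Perm (Fin 3), ∑ σ, centredTriple p (σ * τ.viaEmbedding p) * g σ =
      0 := by
    rw [Finset.sum_comm]
    simp [← Finset.sum_mul, havg]
  simpa [hshift, Fintype.card_perm, Nat.factorial] using hsix

theorem sum_centredTriple_mul_centredTriple {p q : Fin 3 ↪ Fin n}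
    (hpq : ∀ i, q i ∉ Set.range p) : ∑ σ, centredTriple p σ * centredTriple q σ = 0 :=
  sum_centredTriple_mul_eq_zero p _ fun σ τ => by
    simp [centredTriple, Equiv.Perm.viaEmbedding_apply_of_notMem, hpq]

theorem centredTriple_mul_self_le (p : Fin 3 ↪ Fin n) (σ : Equiv.Perm (Fin n)) :
    centredTriple p σ * centredTriple p σ ≤ 1 := by
  unfold centredTriple
  split_ifs <;> norm_num

/-- Chebyshev's inequality for the number of decreasing triples among pairwise disjoint triples of
positions, as a bound for a number of permutations. -/
theorem card_many_decreasing_mul_le {B : ℕ} (p : Fin B → Fin 3 ↪ Fin n)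
    (hp : ∀ b c, b ≠ c → ∀ i, p c i ∉ Set.range (p b)) {x : ℝ} (hx : 0 ≤ x) :
    ((Finset.univ.filter fun σ : Equiv.Perm (Fin n) =>
      x ≤ ∑ b, centredTriple (p b) σ).card : ℝ) * x ^ 2 ≤ B * (n.factorial : ℝ) := by
  have hsq : ∑ σ, (∑ b, centredTriple (p b) σ) ^ 2 ≤ B * (n.factorial : ℝ) := by
    calc ∑ σ, (∑ b, centredTriple (p b) σ) ^ 2
        = ∑ b, ∑ c, ∑ σ, centredTriple (p b) σ * centredTriple (p c) σ := by
          simp only [sq, Finset.sum_mul_sum]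
          rw [Finset.sum_comm]
          exact Finset.sum_congr rfl fun b _ => Finset.sum_comm
      _ ≤ ∑ _b : Fin B, (n.factorial : ℝ) := by
          refine Finset.sum_le_sum fun b _ => ?_
          rw [Finset.sum_eq_single b
            (fun c _ hc => sum_centredTriple_mul_centredTriple (hp b c hc.symm))
            (fun h => absurd (Finset.mem_univ b) h)]
          refine (Finset.sum_le_sum fun σ _ => centredTriple_mul_self_le (p b) σ).trans ?_
          simp [Fintype.card_perm]
      _ = B * (n.factorial : ℝ) := by simp
  refine le_trans ?_ hsq
  rw [← nsmul_eq_mul, ← Finset.sum_const]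
  refine (Finset.sum_le_sum fun σ hσ => ?_).trans
    (Finset.sum_le_sum_of_subset_of_nonneg (Finset.filter_subset _ _) fun σ _ _ => sq_nonneg _)
  exact pow_le_pow_left₀ hx (Finset.mem_filter.1 hσ).2 2

open Classical in
/-- The number of double descents of `σ` in the positions congruent to `c` modulo `3`. -/
noncomputable def doubleDescents (c : ℕ) (σ : Equiv.Perm (Fin n)) : ℕ :=
  ((Finset.range ((n - c) / 3)).filter fun b =>
    3 * b + c ∈ descents σ ∧ 3 * b + c + 1 ∈ descents σ).card

/-- The positions `3 b + c`, `3 b + c + 1` and `3 b + c + 2`. -/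
def consecutiveTriple (c : ℕ) (b : Fin ((n - c) / 3)) : Fin 3 ↪ Fin n where
  toFun i := ⟨3 * b + c + i, by have := b.isLt; have := i.isLt; omega⟩
  inj' i j h := by
    rw [Fin.mk.injEq] at h
    exact Fin.ext (by omega)

theorem sum_centredTriple_consecutiveTriple (c : ℕ) (σ : Equiv.Perm (Fin n)) :
    ∑ b, centredTriple (consecutiveTriple c b) σ =
      doubleDescents c σ - (((n - c) / 3 : ℕ) : ℝ) / 6 := by
  classical
  have hiff : ∀ b : Fin ((n - c) / 3),
      (σ (consecutiveTriple c b 2) < σ (consecutiveTriple c b 1) ∧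
        σ (consecutiveTriple c b 1) < σ (consecutiveTriple c b 0)) ↔
      (3 * (b : ℕ) + c ∈ descents σ ∧ 3 * (b : ℕ) + c + 1 ∈ descents σ) := by
    intro b
    constructor
    · rintro ⟨h1, h2⟩
      exact ⟨⟨_, _, rfl, rfl, h2⟩, ⟨_, _, rfl, rfl, h1⟩⟩
    · rintro ⟨⟨i, j, hi, hj, h2⟩, ⟨k, l, hk, hl, h1⟩⟩
      obtain rfl : i = consecutiveTriple c b 0 := Fin.ext hi
      obtain rfl : j = consecutiveTriple c b 1 := Fin.ext hj
      obtain rfl : k = consecutiveTriple c b 1 := Fin.ext hk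
      obtain rfl : l = consecutiveTriple c b 2 := Fin.ext hl
      exact ⟨h1, h2⟩
  simp only [centredTriple, hiff, Finset.sum_sub_distrib]
  rw [Fin.sum_univ_eq_sum_range (fun b : ℕ =>
    if 3 * b + c ∈ descents σ ∧ 3 * b + c + 1 ∈ descents σ then (1 : ℝ) else 0),
    Finset.sum_boole, doubleDescents]
  simp
  ring

theorem card_many_doubleDescents_mul_le (n c : ℕ) {x : ℝ} (hx : 0 ≤ x) :
    ((Finset.univ.filter fun σ : Equiv.Perm (Fin n) =>
      (((n - c) / 3 : ℕ) : ℝ) / 6 + x ≤ doubleDescents c σ).card : ℝ) * x ^ 2 ≤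
      (((n - c) / 3 : ℕ) : ℝ) * (n.factorial : ℝ) := by
  have h := card_many_decreasing_mul_le (n := n) (consecutiveTriple c)
    (fun b d hbd i => by
      rintro ⟨j, hj⟩
      have : 3 * (b : ℕ) + c + j = 3 * (d : ℕ) + c + i := congrArg Fin.val hj
      have := i.isLt
      have := j.isLt
      exact hbd (Fin.ext (by omega))) hx
  simpa only [sum_centredTriple_consecutiveTriple, le_sub_iff_add_le'] using h

theorem AltChain.length_le_doubleDescents {σ : Equiv.Perm (Fin n)} {m e : ℕ}
    (h : AltChain (descents σ) m e) :
    m ≤ 1 + n / 3 + doubleDescents 0 σ + doubleDescents 1 σ := by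
  classical
  have hlt : ∀ {f}, f ∈ descents σ → f + 1 < n := by
    rintro f ⟨i, j, _, hj, _⟩
    have := j.isLt
    omega
  have hle := h.length_le
  have hsub : ((Finset.range e).filter fun f =>
      f ∈ descents σ ∧ f + 1 ∈ descents σ ∧ f % 3 ≠ 2) ⊆
      (((Finset.range ((n - 0) / 3)).filter fun b =>
        3 * b + 0 ∈ descents σ ∧ 3 * b + 0 + 1 ∈ descents σ).image fun b => 3 * b + 0) ∪
      (((Finset.range ((n - 1) / 3)).filter fun b =>
        3 * b + 1 ∈ descents σ ∧ 3 * b + 1 + 1 ∈ descents σ).image fun b => 3 * b + 1) := by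
    intro f hf
    obtain ⟨_, h0, h1, h2⟩ := Finset.mem_filter.1 hf
    have := hlt h1
    have hcase : f = 3 * (f / 3) + 0 ∨ f = 3 * (f / 3) + 1 := by omega
    rw [Finset.mem_union, Finset.mem_image, Finset.mem_image]
    rcases hcase with hc | hc
    · refine Or.inl ⟨f / 3, Finset.mem_filter.2 ⟨Finset.mem_range.2 (by omega), ?_⟩, hc.symm⟩
      rw [← hc]
      exact ⟨h0, h1⟩
    · refine Or.inr ⟨f / 3, Finset.mem_filter.2 ⟨Finset.mem_range.2 (by omega), ?_⟩, hc.symm⟩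
      rw [← hc]
      exact ⟨h0, h1⟩
  have hcard := (Finset.card_le_card hsub).trans ((Finset.card_union_le _ _).trans
    (add_le_add Finset.card_image_le Finset.card_image_le))
  have he := hlt h.mem
  have hdiv : e / 3 ≤ n / 3 := Nat.div_le_div_right (by omega)
  unfold doubleDescents
  omega

end DoubleDescents

/-! ### Entries in a prescribed rectangle -/

/-- Few permutations avoid a rectangle `P × V` of positions and entries. Swapping the position of
some `v ∈ V` with some `j ∈ P` creates exactly one point in the rectangle; from that point and the
old position of `v` the swap can be undone. -/
theorem card_avoid_mul_le {n : ℕ} (P V : Finset (Fin n)) :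
    (Finset.univ.filter fun σ : Equiv.Perm (Fin n) => ∀ i ∈ P, σ i ∉ V).card *
      (P.card * V.card) ≤ n * n.factorial := by
  have hle : ((Finset.univ.filter fun σ : Equiv.Perm (Fin n) => ∀ i ∈ P, σ i ∉ V) ×ˢ
      (P ×ˢ V)).card ≤ (Finset.univ : Finset (Fin n × Equiv.Perm (Fin n))).card := by
    refine Finset.card_le_card_of_injOn
      (fun x => (x.1⁻¹ x.2.2, x.1 * Equiv.swap (x.1⁻¹ x.2.2) x.2.1))
      (fun _ _ => Finset.mem_coe.2 (Finset.mem_univ _)) ?_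
    rintro ⟨σ, j, v⟩ hx ⟨σ', j', v'⟩ hx' heq
    simp only [Finset.coe_product, Set.mem_prod, Finset.mem_coe, Finset.mem_filter,
      Finset.mem_univ, true_and] at hx hx'
    obtain ⟨hσ, hj, hv⟩ := hx
    obtain ⟨hσ', hj', hv'⟩ := hx'
    obtain ⟨h1, h2⟩ := Prod.mk.inj heq
    simp only at h1 h2
    have hi : σ⁻¹ v ∉ P := fun h => hσ _ h (by simpa using hv)
    have hi' : σ'⁻¹ v' ∉ P := fun h => hσ' _ h (by simpa using hv')
    have e1 : (σ * Equiv.swap (σ⁻¹ v) j) j = v := by simp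
    have e2 : (σ' * Equiv.swap (σ'⁻¹ v') j') j' = v' := by simp
    have ejj : j = j' := by
      by_contra hne
      have hne' : j ≠ σ'⁻¹ v' := fun h => hi' (by rwa [← h])
      have e3 : (σ' * Equiv.swap (σ'⁻¹ v') j') j = σ' j := by
        rw [Equiv.Perm.mul_apply, Equiv.swap_apply_of_ne_of_ne hne' hne]
      rw [← h2, e1] at e3
      exact hσ' j hj (e3 ▸ hv)
    subst ejj
    have evv : v = v' := by rw [← e1, ← e2, h2]
    subst evv
    rw [h1] at h2
    rw [mul_right_cancel h2]
  simpa [Finset.card_product, Fintype.card_perm] using hle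

/-! ### Asymptotically almost sure events -/

/-- It suffices that the exceptional permutations lie in sets `F n` with `|F n| / n! → 0`. -/
theorem HoldsAAS.of_card_le {E : ∀ n : ℕ, Set (Equiv.Perm (Fin n))} {C : ℝ}
    (F : ∀ n : ℕ, Finset (Equiv.Perm (Fin n)))
    (hF : ∀ᶠ n in atTop, ∀ σ, σ ∉ F n → σ ∈ E n)
    (hcard : ∀ᶠ n : ℕ in atTop, ((F n).card : ℝ) * n ≤ C * n.factorial) : HoldsAAS E := by
  have hlow : Tendsto (fun n : ℕ => ENNReal.ofReal (1 - C / n)) atTop (𝓝 1) := by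
    have h : Tendsto (fun n : ℕ => 1 - C / (n : ℝ)) atTop (𝓝 (1 - 0)) :=
      tendsto_const_nhds.sub (tendsto_const_div_atTop_nhds_zero_nat C)
    simpa using ENNReal.tendsto_ofReal h
  refine tendsto_of_tendsto_of_tendsto_of_le_of_le' hlow tendsto_const_nhds ?_
    (Eventually.of_forall fun n => ?_)
  · filter_upwards [hF, hcard, eventually_gt_atTop 0] with n hn hc hpos
    have hfac : (0 : ℝ) < n.factorial := by exact_mod_cast n.factorial_pos
    have hn0 : (0 : ℝ) < n := by exact_mod_cast hpos
    have hsub : (((F n)ᶜ : Finset (Equiv.Perm (Fin n))) : Set (Equiv.Perm (Fin n))) ⊆ E n :=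
      fun σ hσ => hn σ (by simpa using hσ)
    refine le_trans ?_ (MeasureTheory.measure_mono hsub)
    rw [PMF.toOuterMeasure_uniformOfFintype_apply]
    have hcompl : (((F n)ᶜ).card : ℝ) = n.factorial - (F n).card := by
      rw [Finset.card_compl, Nat.cast_sub (Finset.card_le_univ _), Fintype.card_perm,
        Fintype.card_fin]
    have heq : ((Fintype.card ↥(((F n)ᶜ : Finset (Equiv.Perm (Fin n))) :
        Set (Equiv.Perm (Fin n))) : ℕ) : ENNReal) / (Fintype.card (Equiv.Perm (Fin n)) : ℕ) =
        ENNReal.ofReal ((((F n)ᶜ).card : ℝ) / n.factorial) := by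
      rw [ENNReal.ofReal_div_of_pos hfac, ENNReal.ofReal_natCast, ENNReal.ofReal_natCast,
        Fintype.card_perm, Fintype.card_fin]
      simp only [Finset.coe_sort_coe, Fintype.card_coe]
    rw [heq]
    refine ENNReal.ofReal_le_ofReal ?_
    rw [hcompl, sub_div, div_self hfac.ne']
    refine sub_le_sub_left ?_ 1
    rw [div_le_div_iff₀ hfac hn0]
    exact hc
  · exact (MeasureTheory.measure_mono (Set.subset_univ _)).trans_eq
      ((PMF.toOuterMeasure_apply_eq_one_iff _ _).2 (Set.subset_univ _))

/-! ### The lower bound -/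

open Classical in
/-- The permutations that avoid the rectangle of positions in `[a, a + d)` and entries in
`[v, v + d)`. -/
noncomputable def avoiding (n a v d : ℕ) : Finset (Equiv.Perm (Fin n)) :=
  Finset.univ.filter fun σ => ∀ i : Fin n, a ≤ (i : ℕ) → (i : ℕ) < a + d →
    ¬(v ≤ (σ i : ℕ) ∧ (σ i : ℕ) < v + d)

theorem card_avoiding_mul_le {n a v d : ℕ} (ha : a + d ≤ n) (hv : v + d ≤ n) :
    (avoiding n a v d).card * (d * d) ≤ n * n.factorial := by
  classical
  have hcard : ∀ b : ℕ, b + d ≤ n →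
      (Finset.univ.filter fun i : Fin n => b ≤ (i : ℕ) ∧ (i : ℕ) < b + d).card = d := by
    intro b hb
    rw [← Finset.card_map Fin.valEmbedding]
    have hmap : (Finset.univ.filter fun i : Fin n =>
        b ≤ (i : ℕ) ∧ (i : ℕ) < b + d).map Fin.valEmbedding = Finset.Ico b (b + d) := by
      ext x
      simp only [Finset.mem_map, Finset.mem_filter, Finset.mem_univ, true_and,
        Fin.valEmbedding_apply, Finset.mem_Ico]
      exact ⟨by rintro ⟨i, hi, rfl⟩; exact hi, fun hx => ⟨⟨x, by omega⟩, hx, rfl⟩⟩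
    rw [hmap, Nat.card_Ico]
    omega
  have h := card_avoid_mul_le
    (Finset.univ.filter fun i : Fin n => a ≤ (i : ℕ) ∧ (i : ℕ) < a + d)
    (Finset.univ.filter fun i : Fin n => v ≤ (i : ℕ) ∧ (i : ℕ) < v + d)
  rw [hcard a ha, hcard v hv] at h
  refine le_trans (Nat.mul_le_mul_right _ (Finset.card_le_card ?_)) h
  intro σ hσ
  simpa [avoiding] using hσ

open Classical in
/-- The permutations with conspicuously many double descents in the positions congruent to `c`
modulo `3`; about `n / 18` are to be expected. -/
noncomputable def manyDoubleDescents (n c : ℕ) : Finset (Equiv.Perm (Fin n)) :=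
  Finset.univ.filter fun σ => (((n - c) / 3 : ℕ) : ℝ) / 6 + n / 60 ≤ doubleDescents c σ

theorem card_manyDoubleDescents_mul_le {n : ℕ} (hn : 0 < n) (c : ℕ) :
    ((manyDoubleDescents n c).card : ℝ) * n ≤ 1200 * n.factorial := by
  have hn0 : (0 : ℝ) < n := by exact_mod_cast hn
  have h := card_many_doubleDescents_mul_le n c (x := (n : ℝ) / 60) (by positivity)
  have hB : (((n - c) / 3 : ℕ) : ℝ) ≤ n / 3 := by
    rw [le_div_iff₀ (by norm_num)]
    exact_mod_cast (Nat.div_mul_le_self _ _).trans (Nat.sub_le n c)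
  have h2 : ((manyDoubleDescents n c).card : ℝ) * ((n : ℝ) / 60) ^ 2 ≤
      n / 3 * n.factorial := by
    refine le_trans (le_of_eq ?_) (h.trans (mul_le_mul_of_nonneg_right hB (by positivity)))
    unfold manyDoubleDescents
    congr
  refine le_of_mul_le_mul_right ?_ hn0
  nlinarith [h2]

theorem holdsAAS_needsAtLeast :
    HoldsAAS (fun n => {σ | NeedsAtLeast σ (0.503 * (n : ℝ))}) := by
  classical
  -- With `d = n / 1000`, an entry below `d` in `[n - 2d, n - d)` followed by an entry of
  -- `[d, 2d)` in `[n - d, n)` keeps the latter entry in the last `2d` positions in the first step.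
  refine HoldsAAS.of_card_le (C := 8002400) (fun n =>
    (avoiding n (n - 2 * (n / 1000)) 0 (n / 1000) ∪
      avoiding n (n - n / 1000) (n / 1000) (n / 1000)) ∪
    (manyDoubleDescents n 0 ∪ manyDoubleDescents n 1)) ?_ ?_
  · filter_upwards [eventually_ge_atTop 1000] with n hn σ hσ t ht
    simp only [Finset.mem_union, not_or] at hσ
    obtain ⟨⟨hA, hB⟩, h0, h1⟩ := hσ
    simp only [avoiding, Finset.mem_filter, Finset.mem_univ, true_and] at hA hB
    push Not at hA hB
    obtain ⟨i, hi1, hi2, _, hi4⟩ := hA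
    obtain ⟨j, hj1, hj2, hj3, hj4⟩ := hB
    simp only [manyDoubleDescents, Finset.mem_filter, Finset.mem_univ, true_and, not_le] at h0 h1
    have hij : i < j := Fin.lt_def.2 (by omega)
    have hstart : (i : ℕ) < runStart σ j := lt_runStart_of_lt hij (Fin.lt_def.2 (by omega))
    have hrefl : (i : ℕ) < reflect σ j := hstart.trans_le (runStart_le_reflect σ j)
    have hd : (((n / 1000 : ℕ) : ℝ)) ≤ n / 1000 := Nat.cast_div_le
    have hB0 : (((n - 0) / 3 : ℕ) : ℝ) ≤ n / 3 := Nat.cast_div_le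
    have hB1 : (((n - 1) / 3 : ℕ) : ℝ) ≤ n / 3 :=
      le_trans (by exact_mod_cast Nat.div_le_div_right (Nat.sub_le n 1)) hB0
    have hn' : (1000 : ℝ) ≤ n := by exact_mod_cast hn
    cases t with
    | zero =>
      rw [Function.iterate_zero, id] at ht
      rw [ht, Equiv.refl_apply] at hi4
      omega
    | succ t =>
      have hlt : (n : ℝ) - 2 * (n / 1000 : ℕ) < reflect σ j := by
        have : n < (reflect σ j : ℕ) + 2 * (n / 1000) := by omega
        have : (n : ℝ) < (reflect σ j : ℕ) + 2 * (n / 1000 : ℕ) := by exact_mod_cast this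
        linarith
      push_cast
      rcases lt_add_of_iterate_pop (K := 2 * (n / 1000)) ht (s := reflect σ j)
        (by rw [pop_reflect]; omega) with h | ⟨m, e, hch, h⟩
      · have h' : ((reflect σ j : ℕ) : ℝ) < 2 * (n / 1000 : ℕ) + t := by exact_mod_cast h
        linarith
      · have h' : ((reflect σ j : ℕ) : ℝ) < 2 * (n / 1000 : ℕ) + t + m := by exact_mod_cast h
        have hm : (m : ℝ) ≤ 1 + (n / 3 : ℕ) + doubleDescents 0 σ + doubleDescents 1 σ := by
          exact_mod_cast hch.length_le_doubleDescents
        have hB2 : ((n / 3 : ℕ) : ℝ) ≤ n / 3 := Nat.cast_div_le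
        linarith
  · filter_upwards [eventually_ge_atTop 1000] with n hn
    have hn0 : (0 : ℝ) < n := by exact_mod_cast (by omega : 0 < n)
    have hd : (n : ℝ) ≤ 2000 * (n / 1000 : ℕ) := by
      exact_mod_cast (by omega : n ≤ 2000 * (n / 1000))
    have hrect : ∀ {k : ℕ}, k * (n / 1000 * (n / 1000)) ≤ n * n.factorial →
        (k : ℝ) * n ≤ 4000000 * n.factorial := by
      intro k hk
      have hk' : (k : ℝ) * ((n / 1000 : ℕ) * (n / 1000 : ℕ)) ≤ n * n.factorial := by
        exact_mod_cast hk
      have hsq : (n : ℝ) * n ≤ 4000000 * ((n / 1000 : ℕ) * (n / 1000 : ℕ)) := by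
        nlinarith [hd]
      refine le_of_mul_le_mul_right ?_ hn0
      nlinarith [mul_le_mul_of_nonneg_left hsq (Nat.cast_nonneg (α := ℝ) k)]
    have hA := hrect (card_avoiding_mul_le (n := n) (a := n - 2 * (n / 1000)) (v := 0)
      (d := n / 1000) (by omega) (by omega))
    have hB := hrect (card_avoiding_mul_le (n := n) (a := n - n / 1000) (v := n / 1000)
      (d := n / 1000) (by omega) (by omega))
    have h0 := card_manyDoubleDescents_mul_le (n := n) (by omega) 0
    have h1 := card_manyDoubleDescents_mul_le (n := n) (by omega) 1
    have hunion := (Finset.card_union_le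
      (avoiding n (n - 2 * (n / 1000)) 0 (n / 1000) ∪
        avoiding n (n - n / 1000) (n / 1000) (n / 1000))
      (manyDoubleDescents n 0 ∪ manyDoubleDescents n 1)).trans
      (add_le_add (Finset.card_union_le _ _) (Finset.card_union_le _ _))
    have hunion' := (Nat.cast_le (α := ℝ)).2 hunion
    push_cast at hunion'
    nlinarith [mul_le_mul_of_nonneg_right hunion' hn0.le]

end PopStack

theorem theorem1 :
    PopStack.HoldsAAS (fun n => {σ | PopStack.NeedsAtLeast σ (0.503 * (n : ℝ))}) ∧
      ∃ c : ℝ, 1 / 2 < c ∧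
        PopStack.HoldsAAS (fun n => {σ | PopStack.NeedsAtLeast σ (c * (n : ℝ))}) :=
  ⟨PopStack.holdsAAS_needsAtLeast, 0.503, by norm_num, PopStack.holdsAAS_needsAtLeast⟩
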